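/- Let $\mathfrak g$ be a finite-dimensional semisimple Lie algebra over an algebraically closed field of characteristic zero (for instance, the Lie algebra of a connected semisimple algebraic group $G$). Fix a Cartan subalgebra $\mathfrak h\subset\mathfrak g$ and a set $\Delta^+$ of positive roots of $(\mathfrak g,\mathfrak h)$. For a dominant integral weight $\nu$, let $V_\nu$ be the irreducible finite-dimensional $\mathfrak g$-module of highest weight $\nu$. For a finite-dimensional $\mathfrak g$-module $M$, let $\operatorname{mult}(V_\nu,M)$ be the multiplicity of $V_\nu$ in $M$, that is, the largest $n$ such that $M$ contains a direct sum of $n$ submodules isomorphic to $V_\nu$. Let $P$ be the Kostant partition function: for $\gamma\in\mathfrak h^*$, $P(\gamma)$ is the number of families $(m_\alpha)_{\alpha\in\Delta^+}$ of non-negative integers with $\gamma=\sum_{\alpha\in\Delta^+}m_\alpha\,\alpha$, i.e. the coefficient of $e^\gamma$ in the expansion of $\prod_{\alpha\in\Delta^+}(1-e^\alpha)^{-1}$. Then for all dominant integral weights $\mu_1,\mu_2,\mu$, $$\operatorname{mult}(V_\mu,\,V_{\mu_1}\otimes V_{\mu_2})\;\le\;P(\mu_1+\mu_2-\mu).$$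 -/

import Mathlib

open scoped TensorProduct

noncomputable section

namespace SemisimpleLie

/-! Throughout, `L` is a finite-dimensional semisimple Lie algebra over an algebraically closed
field `K` of characteristic zero, `H` is a Cartan subalgebra, and `b` is a base of the root system
of `(L, H)`, that is, a choice of simple (equivalently, of positive) roots. -/

section Weights

variable {K L : Type*} [Field K] [CharZero K] [IsAlgClosed K]
  [LieRing L] [LieAlgebra K L] [FiniteDimensional K L] [LieAlgebra.IsSemisimple K L]
  {H : LieSubalgebra K L} [H.IsCartanSubalgebra]

/-- The linear form `μ` on the Cartan subalgebra is a dominant (integral) weight: its value on each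
simple coroot is a non-negative integer. -/
def IsDominantWeight (b : (LieAlgebra.IsKilling.rootSystem H).Base) (μ : Module.Dual K H) : Prop :=
  ∀ i ∈ b.support, ∃ n : ℕ, μ ((LieAlgebra.IsKilling.rootSystem H).coroot i) = n

/-- The finite set of positive roots. -/
def positiveRoots (b : (LieAlgebra.IsKilling.rootSystem H).Base) : Finset H.root :=
  open Classical in Finset.univ.filter fun α => b.IsPos α

/-- The Kostant partition function: the number of families `(m α)` of natural numbers, indexed by
the positive roots `α`, such that `γ = ∑ α, m α • α`. Equivalently, this is the coefficient of
`e ^ γ` in the expansion of the product of `1 / (1 - e ^ α)` over the positive roots `α`. -/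
def kostantPartition (b : (LieAlgebra.IsKilling.rootSystem H).Base) (γ : Module.Dual K H) : ℕ :=
  Nat.card {m : positiveRoots b → ℕ //
    ∑ α : positiveRoots b, m α • (LieAlgebra.IsKilling.rootSystem H).root α = γ}

/-- `V` is the irreducible finite-dimensional `L`-module `V_μ` of highest weight `μ`: it is
irreducible, and it contains a nonzero vector of weight `μ` that is annihilated by all positive
root spaces. -/
structure IsIrreducibleOfHighestWeight (b : (LieAlgebra.IsKilling.rootSystem H).Base)
    (μ : Module.Dual K H) (V : Type*) [AddCommGroup V] [Module K V] [LieRingModule L V]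
    [LieModule K L V] : Prop where
  finiteDimensional : FiniteDimensional K V
  isIrreducible : LieModule.IsIrreducible K L V
  exists_highest_weight_vector : ∃ v : V, v ≠ 0 ∧ (∀ h : H, ⁅(h : L), v⁆ = μ h • v) ∧
    ∀ α ∈ positiveRoots b, ∀ x ∈ LieAlgebra.rootSpace H (α : LieModule.Weight K H L), ⁅x, v⁆ = 0

end Weights

/-- The multiplicity of the irreducible module `V` in the (semisimple) module `M`: the largest `n`
such that `M` contains a direct sum of `n` submodules that are all isomorphic to `V`. -/
def multiplicity (K L V M : Type*) [CommRing K] [LieRing L] [LieAlgebra K L]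
    [AddCommGroup V] [Module K V] [LieRingModule L V] [LieModule K L V]
    [AddCommGroup M] [Module K M] [LieRingModule L M] [LieModule K L M] : ℕ∞ :=
  ⨆ n ∈ {n : ℕ | ∃ W : Fin n → LieSubmodule K L M,
    iSupIndep W ∧ ∀ i, Nonempty (W i ≃ₗ⁅K,L⁆ V)}, (n : ℕ∞)

end SemisimpleLie

end

/-! Copies of $V_\mu$ in $V_{\mu_1}\otimes V_{\mu_2}$ in direct sum give linearly independent
singular vectors of weight $\mu$, so the multiplicity is at most the dimension of the space of such
vectors (`multiplicity_le_finrank_singularVectors`).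

Let $\xi\in V_{\mu_2}^*$ be a lowest weight vector, of weight $-\mu_2$. Contracting with $\xi$ sends
a singular vector $w$ into the weight space $V_{\mu_1}[\mu-\mu_2]$. This map is injective: since
$\mathfrak n^+w=0$, the functionals that contract $w$ to zero form an $\mathfrak n^+$-stable
subspace, and $\xi$ generates the irreducible module $V_{\mu_2}^*$ under $\mathfrak n^+$
(`finrank_singularVectors_tensorProduct_le`).

Finally, $V_{\mu_1}$ is spanned by ordered monomials in the negative root vectors applied to its
highest weight vector, so $\dim V_{\mu_1}[\mu-\mu_2]\le P(\mu_1-(\mu-\mu_2))$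
(`finrank_weightSpace_le_kostantPartition`). -/

noncomputable section

namespace SemisimpleLie

/-! ### Ordered monomials and PBW spanning. -/

section OrderedMonomials

variable {ι K M : Type*} [Field K] [AddCommGroup M] [Module K M]

/-- The vector `f a₁ ^ m a₁ (f a₂ ^ m a₂ (⋯ v))`, where `l = [a₁, a₂, …]`. -/
def orderedMonomial (f : ι → Module.End K M) (v : M) (l : List ι) (m : ι → ℕ) : M :=
  l.foldr (fun a x => (f a ^ m a) x) v

variable (f : ι → Module.End K M) (v : M)

@[simp] lemma orderedMonomial_nil (m : ι → ℕ) : orderedMonomial f v [] m = v := rfl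

@[simp] lemma orderedMonomial_cons (a : ι) (l : List ι) (m : ι → ℕ) :
    orderedMonomial f v (a :: l) m = (f a ^ m a) (orderedMonomial f v l m) := rfl

lemma orderedMonomial_zero (l : List ι) : orderedMonomial f v l 0 = v := by
  induction l with
  | nil => rfl
  | cons a l ih => simp [ih]

lemma orderedMonomial_congr {l : List ι} {m m' : ι → ℕ} (h : ∀ a ∈ l, m a = m' a) :
    orderedMonomial f v l m = orderedMonomial f v l m' := by
  induction l with
  | nil => rfl
  | cons a l ih =>
    rw [orderedMonomial_cons, orderedMonomial_cons, h a (by simp),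
      ih fun c hc => h c (by simp [hc])]

lemma pow_apply_mem_span_orderedMonomial {a : ι} {l : List ι} (ha : a ∉ l) (k : ℕ) {x : M}
    (hx : x ∈ Submodule.span K (Set.range (orderedMonomial f v l))) :
    (f a ^ k) x ∈ Submodule.span K (Set.range (orderedMonomial f v (a :: l))) := by
  classical
  induction hx using Submodule.span_induction with
  | mem x hx =>
    obtain ⟨m, rfl⟩ := hx
    refine Submodule.subset_span ⟨Function.update m a k, ?_⟩
    rw [orderedMonomial_cons, Function.update_self]
    congr 1
    exact orderedMonomial_congr f v fun c hc =>
      Function.update_of_ne (by rintro rfl; exact ha hc) _ _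
  | zero => simp
  | add x y _ _ hx hy => rw [map_add]; exact add_mem hx hy
  | smul c x _ hx => rw [map_smul]; exact Submodule.smul_mem _ _ hx

lemma apply_head_mem_span_orderedMonomial {a : ι} {l : List ι} (ha : a ∉ l) {x : M}
    (hx : x ∈ Submodule.span K (Set.range (orderedMonomial f v (a :: l)))) :
    f a x ∈ Submodule.span K (Set.range (orderedMonomial f v (a :: l))) := by
  induction hx using Submodule.span_induction with
  | mem x hx =>
    obtain ⟨m, rfl⟩ := hx
    rw [orderedMonomial_cons, ← Module.End.mul_apply, ← pow_succ']
    exact pow_apply_mem_span_orderedMonomial f v ha _ (Submodule.subset_span ⟨m, rfl⟩)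
  | zero => simp
  | add x y _ _ hx hy => rw [map_add]; exact add_mem hx hy
  | smul c x _ hx => rw [map_smul]; exact Submodule.smul_mem _ _ hx

/-- The spanning half of the Poincaré–Birkhoff–Witt theorem: if the commutator of an operator with
a later one is a combination of operators that come strictly later than the first, then the span
of the ordered monomials is stable under all the operators. -/
lemma apply_mem_span_orderedMonomial {l : List ι} (hl : l.Nodup)
    (hcomm : ∀ a t, a :: t <:+ l → ∀ y ∈ t,
      f y * f a - f a * f y ∈ Submodule.span K (f '' {z | z ∈ t})) :
    ∀ a ∈ l, ∀ x ∈ Submodule.span K (Set.range (orderedMonomial f v l)),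
      f a x ∈ Submodule.span K (Set.range (orderedMonomial f v l)) := by
  induction l with
  | nil => simp
  | cons a t ih =>
    obtain ⟨hat, ht⟩ := List.nodup_cons.mp hl
    have ih := ih ht fun c s hs => hcomm c s (hs.trans (List.suffix_cons a t))
    set X := Submodule.span K (Set.range (orderedMonomial f v (a :: t)))
    -- Induction on `k` through `f y * f a = (f y * f a - f a * f y) + f a * f y`. The claim covers
    -- all `y ∈ t` at once because the commutator brings in other operators from `t`.
    have key : ∀ k : ℕ, ∀ y ∈ t, ∀ x ∈ Submodule.span K (Set.range (orderedMonomial f v t)),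
        f y ((f a ^ k) x) ∈ X := by
      intro k
      induction k with
      | zero =>
        intro y hy x hx
        exact pow_apply_mem_span_orderedMonomial f v hat 0 (ih y hy x hx)
      | succ k ihk =>
        intro y hy x hx
        have hc : ∀ g ∈ Submodule.span K (f '' {z | z ∈ t}), g ((f a ^ k) x) ∈ X := by
          intro g hg
          induction hg using Submodule.span_induction with
          | mem g hg => obtain ⟨z, hz, rfl⟩ := hg; exact ihk z hz x hx
          | zero => simp
          | add g g' _ _ h h' => exact add_mem h h'
          | smul c g _ h => exact Submodule.smul_mem _ _ h
        have h1 := hc _ (hcomm a t (List.suffix_refl _) y hy)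
        have h2 := apply_head_mem_span_orderedMonomial f v hat (ihk y hy x hx)
        have h3 := add_mem h1 h2
        simpa [pow_succ'] using h3
    intro y hy x hx
    rcases List.mem_cons.mp hy with rfl | hy
    · exact apply_head_mem_span_orderedMonomial f v hat hx
    · induction hx using Submodule.span_induction with
      | mem x hx =>
        obtain ⟨m, rfl⟩ := hx
        exact key _ y hy _ (Submodule.subset_span ⟨m, rfl⟩)
      | zero => simp
      | add x x' _ _ hx hx' => rw [map_add]; exact add_mem hx hx'
      | smul c x _ hx => rw [map_smul]; exact Submodule.smul_mem _ _ hx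

end OrderedMonomials

/-! ### Generation of irreducible modules, and their duals. -/

section Irreducible

variable {K L M : Type*} [Field K] [LieRing L] [LieAlgebra K L]
  [AddCommGroup M] [Module K M] [LieRingModule L M] [LieModule K L M]

/-- If `L = N + P` and `v` is a nonzero common eigenvector of `P` in an irreducible module, then
the only subspace that contains `v` and is stable under `N` is the whole module. -/
lemma eq_top_of_mem_of_stable [LieModule.IsIrreducible K L M] {N P : Submodule K L}
    (hNP : N ⊔ P = ⊤) {v : M} (hv : v ≠ 0) (hP : ∀ y ∈ P, ∃ c : K, ⁅y, v⁆ = c • v)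
    {Y : Submodule K M} (hvY : v ∈ Y) (hY : ∀ y ∈ N, ∀ x ∈ Y, ⁅y, x⁆ ∈ Y) : Y = ⊤ := by
  -- The smallest candidate `X` turns out to be `L`-stable, hence everything.
  let X : Submodule K M := sInf {Z | v ∈ Z ∧ ∀ y ∈ N, ∀ x ∈ Z, ⁅y, x⁆ ∈ Z}
  have hvX : v ∈ X := Submodule.mem_sInf.mpr fun Z hZ => hZ.1
  have hX : ∀ y ∈ N, ∀ x ∈ X, ⁅y, x⁆ ∈ X := fun y hy x hx =>
    Submodule.mem_sInf.mpr fun Z hZ => hZ.2 y hy x (Submodule.mem_sInf.mp hx Z hZ)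
  -- `X'` consists of the vectors of `X` that all of `L` sends into `X`. It contains `v` because `L
  -- = N + P`, and is `N`-stable by the Leibniz rule, so minimality forces `X ≤ X'`.
  let X' : Submodule K M :=
    { carrier := {x | x ∈ X ∧ ∀ y : L, ⁅y, x⁆ ∈ X}
      add_mem' := fun ha hb => ⟨add_mem ha.1 hb.1, fun y => by
        rw [lie_add]; exact add_mem (ha.2 y) (hb.2 y)⟩
      zero_mem' := ⟨zero_mem _, fun y => by simp⟩
      smul_mem' := fun c x hx => ⟨X.smul_mem c hx.1, fun y => by
        rw [lie_smul]; exact X.smul_mem c (hx.2 y)⟩ }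
  have hXX' : X ≤ X' := by
    refine sInf_le ⟨⟨hvX, fun y => ?_⟩, fun z hz x hx => ⟨hX z hz x hx.1, fun y => ?_⟩⟩
    · obtain ⟨n, hn, p, hp, rfl⟩ := Submodule.mem_sup.mp (hNP ▸ Submodule.mem_top : y ∈ N ⊔ P)
      obtain ⟨c, hc⟩ := hP p hp
      rw [add_lie, hc]
      exact add_mem (hX n hn v hvX) (X.smul_mem c hvX)
    · rw [leibniz_lie]
      exact add_mem (hx.2 _) (hX z hz _ (hx.2 y))
  let W : LieSubmodule K L M := { X with lie_mem := fun {y x} hx => (hXX' hx).2 y }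
  have hW : W = ⊤ := (eq_bot_or_eq_top W).resolve_left fun h => hv <| by
    have : v ∈ W := hvX
    simpa [h] using this
  refine top_le_iff.mp fun x _ => ?_
  have hx : x ∈ W := hW ▸ LieSubmodule.mem_top x
  exact Submodule.mem_sInf.mp hx Y ⟨hvY, hY⟩

/-- The dual of a finite-dimensional irreducible module is irreducible. -/
lemma isIrreducible_dual [FiniteDimensional K M] [LieModule.IsIrreducible K L M] :
    LieModule.IsIrreducible K L (Module.Dual K M) := by
  have : Nontrivial M := LieModule.nontrivial_of_isIrreducible K L M
  refine LieModule.IsIrreducible.mk fun N hN => ?_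
  -- The common kernel of `N` is a submodule of `M`, hence `⊤` or `⊥`; in finite dimension it
  -- determines `N`.
  let W : LieSubmodule K L M :=
    { N.toSubmodule.dualCoannihilator with
      lie_mem := fun {y x} hx => by
        refine (Submodule.mem_dualCoannihilator _).mpr fun φ hφ => ?_
        have := (Submodule.mem_dualCoannihilator _).mp hx _ (N.lie_mem (x := y) hφ)
        simpa using this }
  by_cases hW : W = ⊤
  · refine absurd ?_ hN
    refine (LieSubmodule.eq_bot_iff _).mpr fun φ hφ => ?_
    ext x
    have hx : x ∈ W := hW ▸ LieSubmodule.mem_top x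
    exact (Submodule.mem_dualCoannihilator _).mp hx φ hφ
  · have hW : W = ⊥ := (eq_bot_or_eq_top W).resolve_right hW
    have h1 : N.toSubmodule.dualCoannihilator = ⊥ := by
      rw [← LieSubmodule.bot_toSubmodule (R := K) (L := L), ← hW]
    have h2 := Subspace.dualCoannihilator_dualAnnihilator_eq (W := N.toSubmodule)
    rw [h1, Submodule.dualAnnihilator_bot] at h2
    exact (LieSubmodule.toSubmodule_eq_top N).mp h2.symm

end Irreducible

/-! ### Spanning families of weight vectors. -/

section WeightVectors

variable {K L M ι : Type*} [Field K] [LieRing L] [LieAlgebra K L] [LieRing.IsNilpotent L]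
  [AddCommGroup M] [Module K M] [LieRingModule L M] [LieModule K L M]
  {u : ι → M} {wt : ι → L → K}

lemma eq_zero_of_mem_weightSpace_of_mem_span (hu : ∀ i, u i ∈ LieModule.weightSpace M (wt i))
    {χ : L → K} {x : M} (hx : x ∈ LieModule.weightSpace M χ)
    (hx' : x ∈ Submodule.span K (u '' {i | wt i ≠ χ})) : x = 0 := by
  have hle : Submodule.span K (u '' {i | wt i ≠ χ}) ≤
      (⨆ ψ, ⨆ (_ : ψ ≠ χ), LieModule.genWeightSpace M ψ).toSubmodule := by
    rw [Submodule.span_le]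
    rintro _ ⟨i, hi, rfl⟩
    exact (le_iSup₂_of_le (f := fun ψ (_ : ψ ≠ χ) => LieModule.genWeightSpace M ψ)
      (wt i) hi le_rfl) (LieModule.weightSpace_le_genWeightSpace M _ (hu i))
  have hdisj := LieModule.iSupIndep_genWeightSpace K L M χ
  rw [← LieSubmodule.disjoint_toSubmodule] at hdisj
  exact Submodule.disjoint_def.mp hdisj x
    (LieModule.weightSpace_le_genWeightSpace M _ hx) (hle hx')

/-- Remove from a weight vector its component along the `u i` of weight `χ`: the remainder has
weight `χ` yet lies in the span of the other weights, so it vanishes by independence of weight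
spaces. -/
lemma weightSpace_le_span (hu : ∀ i, u i ∈ LieModule.weightSpace M (wt i))
    (hspan : Submodule.span K (Set.range u) = ⊤) (χ : L → K) :
    (LieModule.weightSpace M χ).toSubmodule ≤ Submodule.span K (u '' {i | wt i = χ}) := by
  intro x hx
  have hsup : Submodule.span K (u '' {i | wt i = χ}) ⊔ Submodule.span K (u '' {i | wt i ≠ χ}) =
      ⊤ := by
    rw [← Submodule.span_union, ← Set.image_union, ← hspan, ← Set.image_univ]
    congr 2
    ext i
    simp [em]
  obtain ⟨y, hy, z, hz, rfl⟩ := Submodule.mem_sup.mp (hsup ▸ Submodule.mem_top :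
    x ∈ Submodule.span K (u '' {i | wt i = χ}) ⊔ Submodule.span K (u '' {i | wt i ≠ χ}))
  have hyχ : y ∈ (LieModule.weightSpace M χ).toSubmodule := by
    refine (Submodule.span_le.mpr ?_) hy
    rintro _ ⟨i, hi, rfl⟩
    exact hi ▸ hu i
  have hzχ : z ∈ LieModule.weightSpace M χ := by
    have := sub_mem hx hyχ
    rwa [add_sub_cancel_left] at this
  rw [eq_zero_of_mem_weightSpace_of_mem_span hu hzχ hz, add_zero]
  exact hy

end WeightVectors

/-! ### Root vectors, heights and finiteness of Kostant partitions. -/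

section RootVectors

open LieAlgebra LieAlgebra.IsKilling

variable {K L : Type*} [Field K] [CharZero K] [IsAlgClosed K]
  [LieRing L] [LieAlgebra K L] [FiniteDimensional K L] [LieAlgebra.IsSemisimple K L]
  {H : LieSubalgebra K L} [H.IsCartanSubalgebra]

/-- Turns linear relations between roots into integer relations between heights, by characteristic
zero. -/
lemma exists_height_functional (b : (rootSystem H).Base) :
    ∃ δ : Module.Dual K H →ₗ[K] K, ∀ α : H.root, δ ((rootSystem H).root α) = b.height α := by
  refine ⟨b.toWeightBasis.constr K fun _ => 1, fun α => ?_⟩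
  obtain ⟨f, -, -, hf⟩ := b.exists_root_eq_sum_int α
  rw [RootPairing.Base.height_eq_sum hf, hf, map_sum, Int.cast_sum]
  refine Finset.sum_congr rfl fun j hj => ?_
  have := b.toWeightBasis.constr_basis K (fun _ => (1 : K)) ⟨j, hj⟩
  rw [RootPairing.Base.toWeightBasis_apply] at this
  rw [map_zsmul, this, zsmul_eq_mul, mul_one]

lemma exists_rootSpace_eq_span {α : LieModule.Weight K H L} (hα : α.IsNonZero) :
    ∃ x : L, (rootSpace H α).toSubmodule = Submodule.span K {x} := by
  obtain ⟨⟨x, hx⟩, -, h⟩ := finrank_eq_one_iff'.mp (finrank_rootSpace_eq_one α hα)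
  refine ⟨x, le_antisymm (fun y hy => ?_) (by simpa using hx)⟩
  obtain ⟨c, hc⟩ := h ⟨y, hy⟩
  exact Submodule.mem_span_singleton.mpr ⟨c, congrArg Subtype.val hc⟩

/-- A generator of the root space of `α`. -/
def rootVector (α : H.root) : L :=
  (exists_rootSpace_eq_span (H.isNonZero_coe_root α)).choose

lemma rootSpace_eq_span_rootVector (α : H.root) :
    (rootSpace H (α : LieModule.Weight K H L)).toSubmodule = Submodule.span K {rootVector α} :=
  (exists_rootSpace_eq_span (H.isNonZero_coe_root α)).choose_spec

lemma rootVector_mem (α : H.root) :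
    rootVector α ∈ rootSpace H (α : LieModule.Weight K H L) := by
  have : rootVector α ∈ Submodule.span K {rootVector α} := Submodule.mem_span_singleton_self _
  rwa [← rootSpace_eq_span_rootVector] at this

/-- The root opposite to `α`. -/
def negRoot (α : H.root) : H.root :=
  ⟨-α, by simpa using LieModule.Weight.IsNonZero.neg (H.isNonZero_coe_root α)⟩

lemma root_negRoot (α : H.root) :
    (rootSystem H).root (negRoot α) = -(rootSystem H).root α := rfl

variable (b : (rootSystem H).Base)

@[simp] lemma mem_positiveRoots {α : H.root} : α ∈ positiveRoots b ↔ 0 < b.height α := by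
  simp [positiveRoots, RootPairing.Base.isPos_iff]

lemma height_negRoot (α : H.root) : b.height (negRoot α) = -b.height α := by
  obtain ⟨δ, hδ⟩ := exists_height_functional b
  have := hδ (negRoot α)
  rw [root_negRoot, map_neg, hδ] at this
  exact_mod_cast this.symm

/-- The root vector of a negative root, indexed by the opposite positive root. -/
def loweringVector (α : positiveRoots b) : L := rootVector (negRoot α.1)

/-- The root vector of a positive root. -/
def raisingVector (α : positiveRoots b) : L := rootVector α.1

/-- The bracket lies in the root space of $-(\alpha+\beta)$, which is zero or a line spanned by a
lowering vector. Only the height is recorded, which is all that the ordering argument needs. -/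
lemma lie_loweringVector (α β : positiveRoots b) :
    ⁅loweringVector b α, loweringVector b β⁆ ∈ Submodule.span K
      (loweringVector b '' {γ | b.height γ.1 = b.height α.1 + b.height β.1}) := by
  obtain ⟨δ, hδ⟩ := exists_height_functional b
  have hmem := lie_mem_genWeightSpace_of_mem_genWeightSpace
    (rootVector_mem (negRoot α.1)) (rootVector_mem (negRoot β.1))
  set χ : H → K := ⇑(negRoot α.1).1 + ⇑(negRoot β.1).1
  by_cases hχ : rootSpace H χ = ⊥
  · have hmem : ⁅rootVector (negRoot α.1), rootVector (negRoot β.1)⁆ ∈ rootSpace H χ := hmem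
    rw [hχ] at hmem
    have : ⁅loweringVector b α, loweringVector b β⁆ = 0 := hmem
    rw [this]
    exact zero_mem _
  let ψ : LieModule.Weight K H L := ⟨χ, hχ⟩
  have hψ : ψ.toLinear = -((rootSystem H).root α.1 + (rootSystem H).root β.1) := by
    rw [neg_add, ← root_negRoot, ← root_negRoot]
    rfl
  have hα := (mem_positiveRoots b).mp α.2
  have hβ := (mem_positiveRoots b).mp β.2
  have hψ0 : ψ.IsNonZero := fun h => by
    have h0 : ψ.toLinear = 0 := by ext x; exact congrFun h x
    have := congrArg δ hψ
    rw [h0, map_zero, map_neg, map_add, hδ, hδ] at this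
    have : b.height α.1 + b.height β.1 = 0 := by exact_mod_cast neg_eq_zero.mp this.symm
    omega
  let γ' : H.root := ⟨ψ, by simpa using hψ0⟩
  have hγ' : b.height γ' = -(b.height α.1 + b.height β.1) := by
    have := hδ γ'
    rw [show (rootSystem H).root γ' = ψ.toLinear from rfl, hψ, map_neg, map_add, hδ, hδ] at this
    exact_mod_cast this.symm
  have hγ : b.height (negRoot γ') = b.height α.1 + b.height β.1 := by
    rw [height_negRoot, hγ', neg_neg]
  have hnn : negRoot (negRoot γ') = γ' := Subtype.ext (neg_neg ψ)
  have hmem' : ⁅loweringVector b α, loweringVector b β⁆ ∈ Submodule.span K {rootVector γ'} := by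
    rw [← rootSpace_eq_span_rootVector]
    exact hmem
  refine Submodule.span_mono ?_ hmem'
  rw [Set.singleton_subset_iff]
  refine ⟨⟨negRoot γ', (mem_positiveRoots b).mpr (by omega)⟩, hγ, ?_⟩
  exact congrArg rootVector hnn

lemma span_lowering_sup_cartan_sup_span_raising :
    Submodule.span K (Set.range (loweringVector b)) ⊔ H.toSubmodule ⊔
      Submodule.span K (Set.range (raisingVector b)) = ⊤ := by
  have h := congrArg LieSubmodule.toSubmodule (cartan_sup_iSup_rootSpace_eq_top (K := K) H)
  simp only [LieSubmodule.sup_toSubmodule, LieSubmodule.iSup_toSubmodule,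
    LieSubmodule.top_toSubmodule] at h
  rw [eq_top_iff, ← h]
  refine sup_le ?_ (iSup₂_le fun α hα => ?_)
  · exact le_sup_of_le_left le_sup_right
  · let α' : H.root := ⟨α, by simpa using hα⟩
    rw [rootSpace_eq_span_rootVector α', Submodule.span_singleton_le_iff_mem]
    rcases lt_or_gt_of_ne (b.height_ne_zero α') with h | h
    · refine Submodule.mem_sup_left (Submodule.mem_sup_left (Submodule.subset_span
        ⟨⟨negRoot α', (mem_positiveRoots b).mpr (by rw [height_negRoot]; omega)⟩, ?_⟩))
      exact congrArg rootVector (Subtype.ext (neg_neg α))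
    · exact Submodule.mem_sup_right (Submodule.subset_span
        ⟨⟨α', (mem_positiveRoots b).mpr h⟩, rfl⟩)

/-- The weight space on which `H` acts by `χ` is moved by a root vector. -/
lemma rootVector_lie_mem_weightSpace {M : Type*} [AddCommGroup M] [Module K M]
    [LieRingModule L M] [LieModule K L M] (α : H.root) {χ : Module.Dual K H} {x : M}
    (hx : x ∈ LieModule.weightSpace M χ) :
    ⁅rootVector α, x⁆ ∈ LieModule.weightSpace M ((rootSystem H).root α + χ) := by
  rw [LieModule.mem_weightSpace] at hx ⊢
  intro h
  have h1 := lie_eq_smul_of_mem_rootSpace (rootVector_mem α) h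
  have hx : ⁅(h : L), x⁆ = χ h • x := hx h
  change ⁅(h : L), ⁅rootVector α, x⁆⁆ = _
  rw [leibniz_lie, hx, lie_smul, show ⁅(h : L), rootVector α⁆ = _ from h1, smul_lie, ← add_smul]
  rfl

/-- There are only finitely many families counted by the Kostant partition function. -/
lemma finite_kostantPartition (γ : Module.Dual K H) :
    Finite {m : positiveRoots b → ℕ // ∑ α : positiveRoots b, m α • (rootSystem H).root α = γ} := by
  classical
  obtain ⟨δ, hδ⟩ := exists_height_functional b
  -- Applying `δ` fixes the height-weighted sum of the `m α`; as positive roots have height at least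
  -- 1, each `m α` is bounded by it.
  have key : ∀ m : positiveRoots b → ℕ,
      δ (∑ α : positiveRoots b, m α • (rootSystem H).root α) =
        ((∑ α : positiveRoots b, m α * (b.height α.1).toNat : ℕ) : K) := by
    intro m
    rw [map_sum, Nat.cast_sum]
    refine Finset.sum_congr rfl fun α _ => ?_
    have hα := (mem_positiveRoots b).mp α.2
    rw [map_nsmul, hδ, nsmul_eq_mul, Nat.cast_mul]
    congr 1
    have : ((b.height α.1).toNat : ℤ) = b.height α.1 := Int.toNat_of_nonneg hα.le
    exact_mod_cast congrArg (Int.cast : ℤ → K) this.symm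
  rcases isEmpty_or_nonempty {m : positiveRoots b → ℕ //
    ∑ α : positiveRoots b, m α • (rootSystem H).root α = γ} with h | ⟨⟨m₀, hm₀⟩⟩
  · infer_instance
  set N := ∑ α : positiveRoots b, m₀ α * (b.height α.1).toNat
  refine Set.Finite.subset (Set.finite_Icc 0 fun _ : positiveRoots b => N)
    fun m hm => ⟨fun _ => Nat.zero_le _, ?_⟩
  have hmN : ∑ α : positiveRoots b, m α * (b.height α.1).toNat = N := by
    have h1 := key m
    rw [show _ = γ from hm, ← hm₀, key m₀] at h1
    exact_mod_cast h1.symm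
  intro α
  have hα := (mem_positiveRoots b).mp α.2
  calc m α ≤ m α * (b.height α.1).toNat := Nat.le_mul_of_pos_right _ (by omega)
    _ ≤ N := hmN ▸ Finset.single_le_sum
      (f := fun α : positiveRoots b => m α * (b.height α.1).toNat) (by simp) (Finset.mem_univ α)

/-- Otherwise the multiples `k • m` would be infinitely many partitions of 0. -/
lemma eq_zero_of_sum_smul_root_eq_zero {m : positiveRoots b → ℕ}
    (hm : ∑ α : positiveRoots b, m α • (rootSystem H).root α = 0) : m = 0 := by
  have := finite_kostantPartition b 0
  by_contra h
  obtain ⟨α, hα⟩ := Function.ne_iff.mp h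
  refine not_injective_infinite_finite (fun k : ℕ => (⟨k • m, ?_⟩ :
    {m : positiveRoots b → ℕ // ∑ α : positiveRoots b, m α • (rootSystem H).root α = 0})) ?_
  · simp only [Pi.smul_apply, smul_assoc, ← Finset.smul_sum, hm, smul_zero]
  · intro k l hkl
    have := congrFun (congrArg Subtype.val hkl) α
    exact Nat.eq_of_mul_eq_mul_right (Nat.pos_of_ne_zero hα) this

end RootVectors

/-! ### Vectors killed by a set and scaled by the Cartan subalgebra. -/

section LieModule

variable {K L M : Type*} [Field K] [LieRing L] [LieAlgebra K L]
  [AddCommGroup M] [Module K M] [LieRingModule L M] [LieModule K L M]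

lemma lie_eq_zero_of_mem_span {s : Set L} {v : M} (hs : ∀ y ∈ s, ⁅y, v⁆ = 0) {y : L}
    (hy : y ∈ Submodule.span K s) : ⁅y, v⁆ = 0 := by
  induction hy using Submodule.span_induction with
  | mem y hy => exact hs y hy
  | zero => simp
  | add x y _ _ hx hy => rw [add_lie, hx, hy, add_zero]
  | smul c x _ hx => rw [smul_lie, hx, smul_zero]

lemma exists_lie_eq_smul_of_mem_sup {H : LieSubalgebra K L} [LieRing.IsNilpotent H] {χ : H → K}
    {v : M} (hv : v ∈ LieModule.weightSpace M χ) {s : Set L} (hs : ∀ y ∈ s, ⁅y, v⁆ = 0) {y : L}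
    (hy : y ∈ H.toSubmodule ⊔ Submodule.span K s) : ∃ c : K, ⁅y, v⁆ = c • v := by
  obtain ⟨h, hh, e, he, rfl⟩ := Submodule.mem_sup.mp hy
  refine ⟨χ ⟨h, hh⟩, ?_⟩
  rw [add_lie, lie_eq_zero_of_mem_span hs he, add_zero]
  exact (LieModule.mem_weightSpace χ v).mp hv ⟨h, hh⟩

end LieModule

/-! ### Irreducible highest weight modules: PBW spanning, weight multiplicities, lowest weight
functionals. -/

section HighestWeight

open LieAlgebra LieAlgebra.IsKilling

variable {K L : Type*} [Field K] [CharZero K] [IsAlgClosed K]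
  [LieRing L] [LieAlgebra K L] [FiniteDimensional K L] [LieAlgebra.IsSemisimple K L]
  {H : LieSubalgebra K L} [H.IsCartanSubalgebra] (b : (rootSystem H).Base)
  {M : Type*} [AddCommGroup M] [Module K M] [LieRingModule L M] [LieModule K L M]

/-- The positive roots, listed by increasing height. -/
def positiveRootsByHeight : List (positiveRoots b) :=
  (Finset.univ : Finset (positiveRoots b)).toList.insertionSort
    fun α β => b.height α.1 ≤ b.height β.1

lemma mem_positiveRootsByHeight (α : positiveRoots b) : α ∈ positiveRootsByHeight b := by
  simp [positiveRootsByHeight]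

lemma nodup_positiveRootsByHeight : (positiveRootsByHeight b).Nodup :=
  (List.perm_insertionSort _ _).nodup_iff.mpr (Finset.nodup_toList _)

lemma pairwise_positiveRootsByHeight :
    (positiveRootsByHeight b).Pairwise fun α β => b.height α.1 ≤ b.height β.1 := by
  have h1 : Std.Total fun α β : positiveRoots b => b.height α.1 ≤ b.height β.1 :=
    ⟨fun _ _ => le_total _ _⟩
  have h2 : IsTrans (positiveRoots b) fun α β => b.height α.1 ≤ b.height β.1 :=
    ⟨fun _ _ _ => le_trans⟩
  exact List.pairwise_insertionSort _ _

lemma mem_of_suffix_of_height_lt {α β : positiveRoots b} {t : List (positiveRoots b)}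
    (ht : α :: t <:+ positiveRootsByHeight b) (hβ : b.height α.1 < b.height β.1) : β ∈ t := by
  obtain ⟨s, hs⟩ := ht
  have h1 := mem_positiveRootsByHeight b β
  have h2 := pairwise_positiveRootsByHeight b
  rw [← hs] at h1 h2
  rcases List.mem_append.mp h1 with h | h
  · have := (List.pairwise_append.mp h2).2.2 β h α (by simp)
    omega
  · rcases List.mem_cons.mp h with rfl | h
    · omega
    · exact h

/-- The vectors obtained from `v` by applying the root vectors of the negative roots in a fixed
order. -/
def loweringMonomial (v : M) (m : positiveRoots b → ℕ) : M :=
  orderedMonomial (fun α => LieModule.toEnd K L M (loweringVector b α)) v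
    (positiveRootsByHeight b) m

lemma loweringMonomial_zero (v : M) : loweringMonomial b v 0 = v :=
  orderedMonomial_zero _ _ _

lemma loweringMonomial_mem_weightSpace {v : M} {χ : Module.Dual K H}
    (hv : v ∈ LieModule.weightSpace M χ) (m : positiveRoots b → ℕ) :
    loweringMonomial b v m ∈ LieModule.weightSpace M
      ((χ - ∑ α : positiveRoots b, m α • (rootSystem H).root α : Module.Dual K H) : H → K) := by
  have key : ∀ l : List (positiveRoots b),
      orderedMonomial (fun α => LieModule.toEnd K L M (loweringVector b α)) v l m ∈
        LieModule.weightSpace M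
          ((χ - (l.map fun α => m α • (rootSystem H).root α).sum : Module.Dual K H) : H → K) := by
    intro l
    induction l with
    | nil => simpa using hv
    | cons a l ih =>
      rw [orderedMonomial_cons, List.map_cons, List.sum_cons]
      generalize m a = k
      induction k with
      | zero => simpa using ih
      | succ k ihk =>
        have := rootVector_lie_mem_weightSpace (negRoot a.1) ihk
        have hχ : χ - ((k + 1) • (rootSystem H).root a.1 +
            (l.map fun α => m α • (rootSystem H).root α).sum) = (rootSystem H).root (negRoot a.1) +
            (χ - (k • (rootSystem H).root a.1 +
              (l.map fun α => m α • (rootSystem H).root α).sum)) := by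
          rw [root_negRoot, succ_nsmul]
          abel
        rw [hχ, pow_succ']
        exact this
  have hsum : ∑ α : positiveRoots b, m α • (rootSystem H).root α =
      ((positiveRootsByHeight b).map fun α => m α • (rootSystem H).root α).sum := by
    rw [← Finset.sum_map_toList]
    exact (((List.perm_insertionSort _ _).map _).sum_eq).symm
  rw [hsum]
  exact key _

lemma span_loweringMonomial_eq_top [LieModule.IsIrreducible K L M] {v : M} (hv0 : v ≠ 0)
    {χ : Module.Dual K H} (hv : v ∈ LieModule.weightSpace M χ)
    (hpos : ∀ α, ⁅raisingVector b α, v⁆ = 0) :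
    Submodule.span K (Set.range (loweringMonomial b v)) = ⊤ := by
  set f : positiveRoots b → Module.End K M :=
    fun α => LieModule.toEnd K L M (loweringVector b α) with hf
  -- Commutators add heights, and heights are positive, so in a list sorted by height every root
  -- vector arising from a commutator with `f α` comes after `α`.
  have hstable := apply_mem_span_orderedMonomial f v (nodup_positiveRootsByHeight b) <| by
    intro α t ht β _
    have h1 : f β * f α - f α * f β =
        LieModule.toEnd K L M ⁅loweringVector b β, loweringVector b α⁆ := by
      ext x
      simp [hf]
    rw [h1]
    have h2 := Submodule.mem_map_of_mem (f := (LieModule.toEnd K L M : L →ₗ[K] Module.End K M))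
      (lie_loweringVector b β α)
    rw [Submodule.map_span, Set.image_image] at h2
    refine Submodule.span_mono (Set.image_mono fun γ hγ => ?_) h2
    have hβ := (mem_positiveRoots b).mp β.2
    have hγ : b.height γ.1 = b.height β.1 + b.height α.1 := hγ
    exact mem_of_suffix_of_height_lt b ht (by omega)
  refine eq_top_of_mem_of_stable (N := Submodule.span K (Set.range (loweringVector b)))
    (P := H.toSubmodule ⊔ Submodule.span K (Set.range (raisingVector b)))
    (by rw [← sup_assoc, span_lowering_sup_cartan_sup_span_raising]) hv0 ?_
    (Submodule.subset_span ⟨0, loweringMonomial_zero b v⟩) ?_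
  · refine fun y hy => exists_lie_eq_smul_of_mem_sup hv ?_ hy
    rintro _ ⟨α, rfl⟩
    exact hpos α
  · intro y hy x hx
    induction hy using Submodule.span_induction with
    | mem y hy =>
      obtain ⟨α, rfl⟩ := hy
      exact hstable α (mem_positiveRootsByHeight b α) x hx
    | zero => simp
    | add y z _ _ hy hz => rw [add_lie]; exact add_mem hy hz
    | smul c y _ hy => rw [smul_lie]; exact Submodule.smul_mem _ _ hy

/-- The weight multiplicities of an irreducible highest weight module are bounded by the Kostant
partition function. -/
lemma finrank_weightSpace_le_kostantPartition [LieModule.IsIrreducible K L M] {v : M}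
    (hv0 : v ≠ 0) {χ : Module.Dual K H} (hv : v ∈ LieModule.weightSpace M χ)
    (hpos : ∀ α, ⁅raisingVector b α, v⁆ = 0) [FiniteDimensional K M] (ψ : Module.Dual K H) :
    Module.finrank K (LieModule.weightSpace M ψ : LieSubmodule K H M).toSubmodule ≤
      kostantPartition b (χ - ψ) := by
  have hle := weightSpace_le_span (loweringMonomial_mem_weightSpace b hv)
    (span_loweringMonomial_eq_top b hv0 hv hpos) ψ
  have hset : {m : positiveRoots b → ℕ |
      (⇑(χ - ∑ α : positiveRoots b, m α • (rootSystem H).root α) : H → K) = ψ} =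
      {m | ∑ α : positiveRoots b, m α • (rootSystem H).root α = χ - ψ} := by
    ext m
    simp only [Set.mem_ofPred_eq, DFunLike.coe_fn_eq]
    constructor <;> intro h
    · rw [← h]; abel
    · rw [h]; abel
  rw [hset] at hle
  have hfin : Finite {m : positiveRoots b → ℕ |
      ∑ α : positiveRoots b, m α • (rootSystem H).root α = χ - ψ} :=
    finite_kostantPartition b (χ - ψ)
  have := Fintype.ofFinite {m : positiveRoots b → ℕ |
      ∑ α : positiveRoots b, m α • (rootSystem H).root α = χ - ψ}
  refine (Submodule.finrank_mono hle).trans ?_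
  rw [Set.image_eq_range]
  refine (finrank_range_le_card _).trans_eq ?_
  rw [← Nat.card_eq_fintype_card]
  rfl

/-- The dual module of an irreducible highest weight module of weight `χ` contains a lowest weight
vector of weight `-χ`. -/
lemma exists_lowest_weight_functional [LieModule.IsIrreducible K L M] {v : M} (hv0 : v ≠ 0)
    {χ : Module.Dual K H} (hv : v ∈ LieModule.weightSpace M χ)
    (hpos : ∀ α, ⁅raisingVector b α, v⁆ = 0) :
    ∃ ξ : Module.Dual K M, ξ ≠ 0 ∧ (∀ (h : H) (x : M), ξ ⁅(h : L), x⁆ = χ h * ξ x) ∧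
      ∀ α x, ξ ⁅loweringVector b α, x⁆ = 0 := by
  classical
  have hwt := loweringMonomial_mem_weightSpace b hv
  have hspan := span_loweringMonomial_eq_top b hv0 hv hpos
  set wt : (positiveRoots b → ℕ) → Module.Dual K H :=
    fun m => χ - ∑ α : positiveRoots b, m α • (rootSystem H).root α with hwt_def
  -- `B` will be a complement of the line through `v`; `ξ` is a functional vanishing on `B` and not
  -- at `v`.
  set B := Submodule.span K (loweringMonomial b v '' {m | (wt m : H → K) ≠ χ})
  have hvB : v ∉ B := fun h => hv0 (eq_zero_of_mem_weightSpace_of_mem_span hwt hv h)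
  obtain ⟨ξ, hξv, hξB⟩ := Submodule.exists_dual_map_eq_bot_of_notMem hvB inferInstance
  have hξB : ∀ x ∈ B, ξ x = 0 := fun x hx => by
    have := Submodule.mem_map_of_mem (f := ξ) hx
    rwa [hξB] at this
  -- Only the empty monomial has weight `χ`.
  have hwt0 : ∀ m, m ≠ 0 → (wt m : H → K) ≠ χ := by
    intro m hm h
    rw [DFunLike.coe_fn_eq] at h
    exact hm (eq_zero_of_sum_smul_root_eq_zero b (sub_eq_self.mp h))
  have hB : ∀ (ψ : Module.Dual K H), ψ ≠ χ → ∀ x ∈ LieModule.weightSpace M ψ, ξ x = 0 := by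
    intro ψ hψ x hx
    refine hξB x (Submodule.span_mono (Set.image_mono fun m hm => ?_)
      (weightSpace_le_span hwt hspan ψ hx))
    have hm : (wt m : H → K) = ψ := hm
    change (wt m : H → K) ≠ χ
    rw [hm]
    exact fun h => hψ (DFunLike.coe_injective h)
  refine ⟨ξ, fun h => hξv (by simp [h]), fun h x => ?_, fun α x => ?_⟩
  · have hx : x ∈ Submodule.span K (Set.range (loweringMonomial b v)) := hspan ▸ Submodule.mem_top
    induction hx using Submodule.span_induction with
    | mem x hx =>
      obtain ⟨m, rfl⟩ := hx
      have h1 : ⁅(h : L), loweringMonomial b v m⁆ = wt m h • loweringMonomial b v m :=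
        (LieModule.mem_weightSpace _ _).mp (hwt m) h
      rw [h1, map_smul, smul_eq_mul]
      by_cases hm : m = 0
      · simp [hm, hwt_def]
      · rw [hξB _ (Submodule.subset_span ⟨m, hwt0 m hm, rfl⟩), mul_zero, mul_zero]
    | zero => simp
    | add x y _ _ hx hy => rw [lie_add, map_add, map_add, hx, hy, mul_add]
    | smul c x _ hx => rw [lie_smul, map_smul, map_smul, hx, smul_eq_mul, smul_eq_mul]; ring
  · have hx : x ∈ Submodule.span K (Set.range (loweringMonomial b v)) := hspan ▸ Submodule.mem_top
    induction hx using Submodule.span_induction with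
    | mem x hx =>
      obtain ⟨m, rfl⟩ := hx
      refine hB _ ?_ _ (rootVector_lie_mem_weightSpace (negRoot α.1) (hwt m))
      intro h
      -- If lowering by `α` produced weight `χ`, then `m` with its entry at `α` increased by 1 would
      -- be a nonzero partition of 0.
      have h1 : ∑ β : positiveRoots b, (m + Pi.single α 1 : positiveRoots b → ℕ) β •
          (rootSystem H).root β = 0 := by
        simp only [Pi.add_apply, add_smul, Finset.sum_add_distrib]
        have h2 : ∑ β : positiveRoots b, (Pi.single α 1 : positiveRoots b → ℕ) β •
            (rootSystem H).root β = (rootSystem H).root α := by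
          rw [Finset.sum_eq_single α] <;> simp +contextual
        rw [h2]
        rw [root_negRoot] at h
        have h3 := sub_eq_zero.mpr h
        rw [← neg_eq_zero, ← h3]
        abel
      have := congrFun (eq_zero_of_sum_smul_root_eq_zero b h1) α
      simp at this
    | zero => simp
    | add x y _ _ hx hy => rw [lie_add, map_add, hx, hy, add_zero]
    | smul c x _ hx => rw [lie_smul, map_smul, hx, smul_zero]

end HighestWeight

/-! ### Contraction of a tensor factor. -/

section TensorProduct

open LieAlgebra LieAlgebra.IsKilling

variable {K L : Type*} [Field K] [LieRing L] [LieAlgebra K L]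
  {M N : Type*} [AddCommGroup M] [Module K M] [LieRingModule L M] [LieModule K L M]
  [AddCommGroup N] [Module K N] [LieRingModule L N] [LieModule K L N]

/-- Contraction of the second tensor factor with a linear form. -/
def contract (M : Type*) [AddCommGroup M] [Module K M] (ξ : Module.Dual K N) : M ⊗[K] N →ₗ[K] M :=
  (TensorProduct.rid K M).toLinearMap ∘ₗ ξ.lTensor M

@[simp] lemma contract_tmul (ξ : Module.Dual K N) (x : M) (y : N) :
    contract M ξ (x ⊗ₜ[K] y) = ξ y • x := by
  simp [contract]

lemma contract_add (ξ η : Module.Dual K N) (w : M ⊗[K] N) :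
    contract M (ξ + η) w = contract M ξ w + contract M η w := by
  simp [contract, LinearMap.lTensor_add]

lemma contract_smul (c : K) (ξ : Module.Dual K N) (w : M ⊗[K] N) :
    contract M (c • ξ) w = c • contract M ξ w := by
  simp [contract, LinearMap.lTensor_smul]

/-- This is the `L`-equivariance of the pairing $(M\otimes N)\times N^*\to M$. -/
lemma contract_lie (ξ : Module.Dual K N) (z : L) (w : M ⊗[K] N) :
    contract M ξ ⁅z, w⁆ = ⁅z, contract M ξ w⁆ - contract M ⁅z, ξ⁆ w := by
  induction w using TensorProduct.induction_on with
  | zero => simp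
  | tmul x y => simp [TensorProduct.LieModule.lie_tmul_right]
  | add w w' h h' => rw [lie_add, map_add, map_add, map_add, lie_add, h, h']; abel

lemma eq_zero_of_contract_eq_zero {w : M ⊗[K] N}
    (h : ∀ ξ : Module.Dual K N, contract M ξ w = 0) : w = 0 := by
  classical
  let B := Module.Basis.ofVectorSpace K N
  refine (TensorProduct.equivFinsuppOfBasisRight B).map_eq_zero_iff.mp (Finsupp.ext fun i => ?_)
  rw [TensorProduct.equivFinsuppOfBasisRight_apply]
  exact h (B.coord i)

end TensorProduct

/-! ### Singular vectors and multiplicities. -/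

section Multiplicity

open LieAlgebra LieAlgebra.IsKilling

variable {K L : Type*} [Field K] [CharZero K] [IsAlgClosed K]
  [LieRing L] [LieAlgebra K L] [FiniteDimensional K L] [LieAlgebra.IsSemisimple K L]
  {H : LieSubalgebra K L} [H.IsCartanSubalgebra] (b : (rootSystem H).Base)

/-- The space of the vectors of weight `χ` that are annihilated by all positive root spaces. -/
def singularVectors (M : Type*) [AddCommGroup M] [Module K M] [LieRingModule L M] [LieModule K L M]
    (χ : Module.Dual K H) : Submodule K M :=
  (LieModule.weightSpace M χ : LieSubmodule K H M).toSubmodule ⊓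
    ⨅ α, LinearMap.ker (LieModule.toEnd K L M (raisingVector b α))

variable {M N : Type*} [AddCommGroup M] [Module K M] [LieRingModule L M] [LieModule K L M]
  [AddCommGroup N] [Module K N] [LieRingModule L N] [LieModule K L N]

lemma mem_singularVectors {χ : Module.Dual K H} {x : M} :
    x ∈ singularVectors b M χ ↔
      (∀ h : H, ⁅(h : L), x⁆ = χ h • x) ∧ ∀ α, ⁅raisingVector b α, x⁆ = 0 := by
  simp [singularVectors, LieModule.mem_weightSpace]

lemma IsIrreducibleOfHighestWeight.exists_mem_singularVectors {b : (rootSystem H).Base}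
    {χ : Module.Dual K H} (hM : IsIrreducibleOfHighestWeight b χ M) :
    ∃ v : M, v ≠ 0 ∧ v ∈ singularVectors b M χ := by
  obtain ⟨v, hv0, hv, hpos⟩ := hM.exists_highest_weight_vector
  exact ⟨v, hv0, (mem_singularVectors b).mpr
    ⟨hv, fun α => hpos α.1 α.2 _ (rootVector_mem α.1)⟩⟩

lemma finrank_singularVectors_tensorProduct_le {χ : Module.Dual K H}
    (hN : IsIrreducibleOfHighestWeight b χ N) [FiniteDimensional K M] (ψ : Module.Dual K H) :
    Module.finrank K (singularVectors b (M ⊗[K] N) ψ) ≤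
      Module.finrank K (LieModule.weightSpace M ((ψ - χ : Module.Dual K H) : H → K) :
        LieSubmodule K H M).toSubmodule := by
  have := hN.finiteDimensional
  have := hN.isIrreducible
  obtain ⟨v, hv0, hv⟩ := hN.exists_mem_singularVectors
  obtain ⟨hvχ, hpos⟩ := (mem_singularVectors b).mp hv
  obtain ⟨ξ, hξ0, hξH, hξ⟩ := exists_lowest_weight_functional b hv0
    ((LieModule.mem_weightSpace _ _).mpr hvχ) hpos
  have hξH' : ∀ h : H, ⁅(h : L), ξ⁆ = (-χ) h • ξ := fun h => by
    ext x
    simp [hξH]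
  have hξ' : ∀ α, ⁅loweringVector b α, ξ⁆ = 0 := fun α => by
    ext x
    simp [hξ]
  have hdual : LieModule.IsIrreducible K L (Module.Dual K N) := isIrreducible_dual
  have hmaps : ∀ w ∈ singularVectors b (M ⊗[K] N) ψ, contract M ξ w ∈
      (LieModule.weightSpace M ((ψ - χ : Module.Dual K H) : H → K) :
        LieSubmodule K H M).toSubmodule := by
    intro w hw
    refine (LieModule.mem_weightSpace _ _).mpr fun h => ?_
    have h1 := contract_lie (M := M) ξ (h : L) w
    rw [((mem_singularVectors b).mp hw).1 h, map_smul, hξH', contract_smul] at h1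
    have h2 := eq_add_of_sub_eq h1.symm
    change ⁅(h : L), contract M ξ w⁆ = _
    rw [h2, ← add_smul]
    simp [sub_eq_add_neg]
  refine LinearMap.finrank_le_finrank_of_injective
    (f := (contract M ξ).restrict hmaps) ?_
  rw [← LinearMap.ker_eq_bot, LinearMap.ker_eq_bot']
  rintro ⟨w, hw⟩ hw0
  have hw0 : contract M ξ w = 0 := congrArg Subtype.val hw0
  obtain ⟨-, hwpos⟩ := (mem_singularVectors b).mp hw
  -- Injectivity: `S` contains `ξ` and is stable under raising vectors by `contract_lie`, because
  -- they kill `w`. Since `ξ` is an eigenvector of the Cartan and lowering part, `S` is the whole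
  -- dual, and then `w = 0`.
  let S : Submodule K (Module.Dual K N) :=
    { carrier := {η | contract M η w = 0}
      add_mem' := fun {η η'} hη hη' => by
        change contract M (η + η') w = 0
        rw [contract_add, show contract M η w = 0 from hη, show contract M η' w = 0 from hη',
          add_zero]
      zero_mem' := by
        change contract M 0 w = 0
        simp [contract]
      smul_mem' := fun c η hη => by
        change contract M (c • η) w = 0
        rw [contract_smul, show contract M η w = 0 from hη, smul_zero] }
  have hS : S = ⊤ := by
    refine eq_top_of_mem_of_stable (L := L)
      (N := Submodule.span K (Set.range (raisingVector b)))
      (P := H.toSubmodule ⊔ Submodule.span K (Set.range (loweringVector b))) ?_ hξ0 ?_ hw0 ?_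
    · rw [← span_lowering_sup_cartan_sup_span_raising b]
      ac_rfl
    · refine fun y hy => exists_lie_eq_smul_of_mem_sup
        ((LieModule.mem_weightSpace (⇑(-χ) : H → K) ξ).mpr hξH') ?_ hy
      rintro _ ⟨α, rfl⟩
      exact hξ' α
    · intro y hy η hη
      have hη : contract M η w = 0 := hη
      have hyw : ⁅y, w⁆ = 0 := lie_eq_zero_of_mem_span (by rintro _ ⟨α, rfl⟩; exact hwpos α) hy
      have := contract_lie (M := M) η y w
      rw [hyw, hη, map_zero, lie_zero, zero_sub] at this
      exact neg_eq_zero.mp this.symm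
  have hwz : w = 0 := eq_zero_of_contract_eq_zero fun η => (hS ▸ Submodule.mem_top : η ∈ S)
  exact Subtype.ext hwz

/-- Each copy of `N` contributes the image of its highest weight vector; independence of the copies
makes these images linearly independent. -/
lemma multiplicity_le_finrank_singularVectors {χ : Module.Dual K H}
    (hN : IsIrreducibleOfHighestWeight b χ N) [FiniteDimensional K M] :
    multiplicity K L N M ≤ (Module.finrank K (singularVectors b M χ) : ℕ∞) := by
  obtain ⟨v, hv0, hv⟩ := hN.exists_mem_singularVectors
  obtain ⟨hvχ, hpos⟩ := (mem_singularVectors b).mp hv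
  refine iSup₂_le fun n ⟨W, hW, hWN⟩ => Nat.cast_le.mpr ?_
  have e := fun i => (hWN i).some
  let w : Fin n → M := fun i => ((e i).symm v : W i)
  have hlie : ∀ (y : L) i, ⁅y, w i⁆ = ((e i).symm ⁅y, v⁆ : W i) := fun y i =>
    congrArg Subtype.val ((e i).symm.toLieModuleHom.map_lie y v).symm
  have hw : ∀ i, w i ∈ singularVectors b M χ := fun i => by
    refine (mem_singularVectors b).mpr ⟨fun h => ?_, fun α => ?_⟩
    · rw [hlie, hvχ, map_smul]
      rfl
    · rw [hlie, hpos, map_zero]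
      rfl
  have hli : LinearIndependent K w := by
    refine iSupIndep.linearIndependent (fun i => (W i).toSubmodule)
      (LieSubmodule.iSupIndep_toSubmodule.mpr hW) (fun i => ((e i).symm v).2) fun i h => hv0 ?_
    have : (e i).symm v = 0 := Subtype.ext h
    simpa using congrArg (e i) this
  have hli' : LinearIndependent K fun i => (⟨w i, hw i⟩ : singularVectors b M χ) :=
    LinearIndependent.of_comp (singularVectors b M χ).subtype hli
  simpa using hli'.fintype_card_le_finrank

end Multiplicity

end SemisimpleLie

end

theorem mainTheorem12 {K L : Type*} [Field K] [CharZero K] [IsAlgClosed K]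
    [LieRing L] [LieAlgebra K L] [FiniteDimensional K L] [LieAlgebra.IsSemisimple K L]
    (H : LieSubalgebra K L) [H.IsCartanSubalgebra]
    (b : (LieAlgebra.IsKilling.rootSystem H).Base)
    (μ₁ μ₂ μ : Module.Dual K H)
    (hμ₁ : SemisimpleLie.IsDominantWeight b μ₁) (hμ₂ : SemisimpleLie.IsDominantWeight b μ₂)
    (hμ : SemisimpleLie.IsDominantWeight b μ)
    (V₁ V₂ V : Type*)
    [AddCommGroup V₁] [Module K V₁] [LieRingModule L V₁] [LieModule K L V₁]
    [AddCommGroup V₂] [Module K V₂] [LieRingModule L V₂] [LieModule K L V₂]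
    [AddCommGroup V] [Module K V] [LieRingModule L V] [LieModule K L V]
    (hV₁ : SemisimpleLie.IsIrreducibleOfHighestWeight b μ₁ V₁)
    (hV₂ : SemisimpleLie.IsIrreducibleOfHighestWeight b μ₂ V₂)
    (hV : SemisimpleLie.IsIrreducibleOfHighestWeight b μ V) :
    SemisimpleLie.multiplicity K L V (V₁ ⊗[K] V₂) ≤
      (SemisimpleLie.kostantPartition b (μ₁ + μ₂ - μ) : ℕ∞) := by
  have := hV₁.finiteDimensional
  have := hV₁.isIrreducible
  have := hV₂.finiteDimensional
  obtain ⟨v, hv0, hv⟩ := hV₁.exists_mem_singularVectors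
  obtain ⟨hvμ, hpos⟩ := (SemisimpleLie.mem_singularVectors b).mp hv
  refine (SemisimpleLie.multiplicity_le_finrank_singularVectors b hV).trans (Nat.cast_le.mpr ?_)
  refine (SemisimpleLie.finrank_singularVectors_tensorProduct_le b hV₂ μ).trans ?_
  have h := SemisimpleLie.finrank_weightSpace_le_kostantPartition b hv0
    ((LieModule.mem_weightSpace _ _).mpr hvμ) hpos (μ - μ₂)
  -- $\mu_1-(\mu-\mu_2)=\mu_1+\mu_2-\mu$.
  rwa [sub_sub_eq_add_sub] at h
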